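/- Let $N \ge 0$ and $n_1,\dots,n_N \ge 0$ be integers, and let $\Omega$ be the probability space in which permutations $\pi_1,\dots,\pi_N$, with $\pi_k$ a permutation of $[n_k]$, are chosen uniformly at random and independently. Let $\mathcal B$ be a set of atomic bad events: each $B \in \mathcal B$ is a non-empty set of triples $(k,x,y)$ with $x,y \in [n_k]$, containing no two triples $(k,x,y),(k,x,y')$ with $y \ne y'$ and no two triples $(k,x,y),(k,x',y)$ with $x \neq x'$; $B$ is true for $\pi$ iff $\pi_k(x)=y$ for all $(k,x,y)\in B$. Write $B \sim B'$ iff there are $(k,x,y)\in B$ and $(k,x',y')\in B'$ with $x=x'$ or $y=y'$ (in particular $B\sim B$). The Swapping Algorithm first draws $\pi_1,\dots,\pi_N$ uniformly at random and independently. Then, as long as some bad event in $\mathcal B$ is true, it chooses a true $B \in \mathcal B$ by an arbitrary rule (which may depend on the whole history and may be randomized) and resamples it: independently for each $k$, if $x_1,\dots,x_r$ are the entries of $\pi_k$ involved in $B$ (listed in any order), then for $i=1,\dots,r$ it picks $x_i'$ uniformly at random from $[n_k]\setminus\{x_1,\dots,x_{i-1}\}$ and swaps the entries $x_i$ and $x_i'$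 of $\pi_k$. 1. Suppose that $\mu:\mathcal B\to[0,\infty)$ satisfies, for every $B\in\mathcal B$, $$\mu(B)\ \ge\ P_\Omega(B)\prod_{B'\in\mathcal B,\ B'\sim B}(1+\mu(B')).$$ Then the Swapping Algorithm terminates with probability one, and for each $B \in \mathcal B$ the expected number of iterations in which $B$ is resampled is at most $\mu(B)$. 2. There is an absolute constant $C$ such that the following holds. If $P_\Omega(B)\le p$ for every $B\in\mathcal B$, every $B \in \mathcal B$ satisfies $B\sim B'$ for at most $d$ bad events $B' \in \mathcal B$ with $B' \neq B$, and $e\,p\,(d+1)\le 1$, then the Swapping Algorithm terminates with probability one, and for each $B\in\mathcal B$ the expected number of resamplings of $B$ is at most $C$. -/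

import Mathlib

open MeasureTheory ProbabilityTheory
open scoped ENNReal

namespace SwapLLL

variable {N : ℕ} {n : Fin N → ℕ}

/-- A tuple of permutations `π_1, …, π_N`, where `π_k` is a permutation of an `n_k`-element set. -/
abbrev Config (n : Fin N → ℕ) : Type := (k : Fin N) → Equiv.Perm (Fin (n k))

/-- An atomic bad event: a finite set of triples `(k, x, y)`. -/
abbrev BadEvent (n : Fin N → ℕ) : Type := Finset ((k : Fin N) × (Fin (n k) × Fin (n k)))

/-- The bad event `B` is true for `π` iff `π_k(x) = y` for all triples `(k, x, y)` of `B`. -/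
def Holds (B : BadEvent n) (π : Config n) : Prop :=
  ∀ k x y, ⟨k, (x, y)⟩ ∈ B → π k x = y

/-- `B` contains no two triples `(k, x, y), (k, x, y')` with `y ≠ y'`, and no two triples
`(k, x, y), (k, x', y)` with `x ≠ x'`. -/
def Consistent (B : BadEvent n) : Prop :=
  (∀ k x y y', ⟨k, (x, y)⟩ ∈ B → ⟨k, (x, y')⟩ ∈ B → y = y') ∧
  (∀ k x x' y, ⟨k, (x, y)⟩ ∈ B → ⟨k, (x', y)⟩ ∈ B → x = x')

/-- The bad events `B`, `B'` overlap in a slice of the domain or of the range of a permutation. -/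
def Dep (B B' : BadEvent n) : Prop :=
  ∃ k x y x' y', ⟨k, (x, y)⟩ ∈ B ∧ ⟨k, (x', y')⟩ ∈ B' ∧ (x = x' ∨ y = y')

open Classical in
/-- The bad events `B' ∈ 𝓑` with `B' ∼ B` (`B` itself is one of them, if it is a non-empty member
of `𝓑`). -/
noncomputable def neighbors (𝓑 : Finset (BadEvent n)) (B : BadEvent n) : Finset (BadEvent n) :=
  𝓑.filter (fun B' => Dep B' B)

/-- The law of independent random variables with laws `p k`. -/
noncomputable def prodPMF {ι : Type} [Fintype ι] [DecidableEq ι] {α : ι → Type}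
    [∀ i, Fintype (α i)] (p : (i : ι) → PMF (α i)) : PMF ((i : ι) → α i) :=
  PMF.ofFintype (fun a => ∏ i, p i (a i)) (by
    rw [← Fintype.prod_sum (fun i a => p i a)]
    refine Finset.prod_eq_one fun i _ => ?_
    rw [← tsum_fintype (L := .unconditional _)]
    exact (p i).tsum_coe)

/-- The space `Ω`: the `π_k` are uniformly random and independent. -/
noncomputable def uniformConfig (n : Fin N → ℕ) : PMF (Config n) :=
  prodPMF fun k => PMF.uniformOfFintype (Equiv.Perm (Fin (n k)))

/-- The probability `P_Ω(B)`. -/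
noncomputable def probΩ (B : BadEvent n) : ℝ :=
  ((uniformConfig n).toOuterMeasure {π | Holds B π}).toReal

/-- The loop of the swapping subroutine; `done` is the set of entries treated so far. One by one,
the entry `x` of the list is swapped with a uniformly random entry `x'` outside `done`. (The `else`
branch is never reached when the list has no duplicates and is disjoint from `done`.) -/
noncomputable def swapFrom {m : ℕ} :
    List (Fin m) → Finset (Fin m) → Equiv.Perm (Fin m) → PMF (Equiv.Perm (Fin m))
  | [], _, π => PMF.pure π
  | x :: xs, done, π =>
    if h : (Finset.univ \ done).Nonempty then
      (PMF.uniformOfFinset (Finset.univ \ done) h).bind fun x' =>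
        swapFrom xs (insert x done) (π * Equiv.swap x x')
    else PMF.pure π

/-- The law of the outcome of `Swap(π; x_1, …, x_r)`. -/
noncomputable def swapPMF {m : ℕ} (π : Equiv.Perm (Fin m)) (xs : List (Fin m)) :
    PMF (Equiv.Perm (Fin m)) :=
  swapFrom xs ∅ π

/-- A listing, for every bad event `B` and every `k`, of the entries `x` of `π_k` that are involved
in `B`: this is the order `x_1, …, x_r` in which the swapping subroutine treats them. -/
structure EntryOrder (n : Fin N → ℕ) where
  entries : BadEvent n → (k : Fin N) → List (Fin (n k))
  nodup : ∀ B k, (entries B k).Nodup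
  mem_entries : ∀ B k x, x ∈ entries B k ↔ ∃ y, ⟨k, (x, y)⟩ ∈ B

/-- The law of the outcome of resampling `B` in the configuration `π`: all entries of `π_k` that are
involved in `B` are swapped, independently for the different `k`. -/
noncomputable def resamplePMF (o : EntryOrder n) (B : BadEvent n) (π : Config n) :
    PMF (Config n) :=
  prodPMF fun k => swapPMF (π k) (o.entries B k)

/-- What is recorded at time `t`: the permutations `π^t`, and the bad event that was resampled in
the iteration that led to them (`none` at time `0` and after termination). -/
@[ext] structure State (n : Fin N → ℕ) : Type where
  config : Config n
  last : Option (BadEvent n)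

instance : Finite (State n) :=
  Finite.of_injective (fun s : State n => (s.config, s.last)) (by
    intro s t h
    simp only [Prod.mk.injEq] at h
    exact State.ext h.1 h.2)

instance : MeasurableSpace (State n) := ⊤

instance : DiscreteMeasurableSpace (State n) := ⟨fun _ => trivial⟩

/-- The histories of the process up to time `t`. -/
abbrev History (n : Fin N → ℕ) (t : ℕ) : Type := (i : Finset.Iic t) → State n

/-- The permutations at the end of a history. -/
def History.current {t : ℕ} (h : History n t) : Config n :=
  (h ⟨t, Finset.mem_Iic.2 le_rfl⟩).config

/-- Some bad event is true. -/
def SomeBad (𝓑 : Finset (BadEvent n)) (π : Config n) : Prop :=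
  ∃ B ∈ 𝓑, Holds B π

/-- An arbitrary rule for choosing a true bad event. The choice may depend on the whole history
(including all random choices made so far, which can be read off from it) and may be randomized.
When no bad event is true the rule is not consulted. -/
structure SelectionRule (𝓑 : Finset (BadEvent n)) where
  choose : (t : ℕ) → History n t → PMF (BadEvent n)
  choose_true : ∀ t (h : History n t), SomeBad 𝓑 h.current →
    ∀ B ∈ (choose t h).support, B ∈ 𝓑 ∧ Holds B h.current

open Classical in
/-- One iteration of the main loop: as long as some bad event is true, choose one and resample it;
otherwise nothing happens any more. -/
noncomputable def stepPMF {𝓑 : Finset (BadEvent n)} (o : EntryOrder n) (r : SelectionRule 𝓑)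
    (t : ℕ) (h : History n t) : PMF (State n) :=
  if SomeBad 𝓑 h.current then
    (r.choose t h).bind fun B => (resamplePMF o B h.current).map fun π' => ⟨π', some B⟩
  else PMF.pure ⟨h.current, none⟩

/-- `stepPMF` as a Markov kernel. -/
noncomputable def stepKernel {𝓑 : Finset (BadEvent n)} (o : EntryOrder n) (r : SelectionRule 𝓑)
    (t : ℕ) : Kernel (History n t) (State n) :=
  Kernel.ofFunOfCountable fun h => (stepPMF o r t h).toMeasure

instance {𝓑 : Finset (BadEvent n)} (o : EntryOrder n) (r : SelectionRule 𝓑) (t : ℕ) :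
    IsMarkovKernel (stepKernel o r t) :=
  ⟨fun h => inferInstanceAs (IsProbabilityMeasure (stepPMF o r t h).toMeasure)⟩

/-- The law at time `0`: uniformly random and independent permutations. -/
noncomputable def initialPMF (n : Fin N → ℕ) : PMF (State n) :=
  (uniformConfig n).map fun π => ⟨π, none⟩

/-- The law of the infinite trajectory of the Swapping Algorithm. -/
noncomputable def swappingAlgorithm {𝓑 : Finset (BadEvent n)} (o : EntryOrder n)
    (r : SelectionRule 𝓑) : Measure (ℕ → State n) :=
  Kernel.trajMeasure (X := fun _ => State n) (initialPMF n).toMeasure (stepKernel o r)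

/-- The algorithm terminates on the trajectory `ω`: at some time no bad event is true. -/
def Terminates (𝓑 : Finset (BadEvent n)) (ω : ℕ → State n) : Prop :=
  ∃ t, ¬ SomeBad 𝓑 (ω t).config

open Classical in
/-- The number (possibly `∞`) of iterations in which `B` is resampled. -/
noncomputable def resampleCount (B : BadEvent n) (ω : ℕ → State n) : ℝ≥0∞ :=
  ∑' t : ℕ, if (ω (t + 1)).last = some B then 1 else 0

end SwapLLL

/-! Let A_g be the transition matrix of resampling g, with the rows of the states where g is false
set to zero. Two facts carry the proof: independent events have commuting matrices
(`eventMatrix_commute`), and the uniform law u is a left eigenvector, u A_g = P(g) u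
(`vecMul_eventMatrix`).

The potential of f at σ is the sum of (A_K 1)(σ) over the stable sequences K with first layer {f},
where A_K multiplies the matrices of the layers, deepest layer leftmost. Each term is the
probability that the events of K, resampled from σ with the deepest layer first, are all true at
their turn. Suppose that g is resampled where it is true; the expected potential afterwards is the
sum of the A_g A_K 1. If g depends on a member of K, then A_g A_K belongs to the stable sequence
obtained by adding g to K; otherwise A_g commutes through A_K and A_g 1 ≤ 1. The map on sequences so
defined is injective and misses [{g}], whose term equals 1. Hence the expected potential of f never
increases and drops by at least 1 when f is resampled, whatever the selection rule
(`mulVec_potential_add_le`). Telescoping bounds the expected number of resamplings of f by the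
initial average potential, which by the eigenvector identity is a sum of products of probabilities,
at most μ(f) by induction on the length (`dotProduct_potential_le`). Finitely many finite
expectations force termination.

Both facts are reduced to one permutation and to counting swap choices: the order of the swapped
entries is irrelevant (`swapSum_perm`), and each outcome arises exactly once from the permutations
that satisfy the event (`sum_swapSum_eq_one`). -/

namespace SwapLLL

set_option linter.unusedSectionVars false

/-! ### Stable sequences of layers -/

section Layers

variable {F : Type*} (dep : F → F → Prop) (𝓑 : Finset F)

/-- A layer: a nonempty independent set of members of `𝓑`. -/
structure IsLayer (S : Finset F) : Prop where
  nonempty : S.Nonempty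
  subset : S ⊆ 𝓑
  indep : ∀ f ∈ S, ∀ g ∈ S, f ≠ g → ¬ dep f g

/-- A sequence of layers in which every member of a layer depends on some member of the layer
just before it. -/
def Stable : List (Finset F) → Prop
  | [] => True
  | S :: L => IsLayer dep 𝓑 S ∧ (∀ T ∈ L.head?, ∀ g ∈ T, ∃ f ∈ S, dep g f) ∧ Stable L

/-- `g` depends on some member of some layer of `K`. -/
def Touches (g : F) (K : List (Finset F)) : Prop := ∃ S ∈ K, ∃ f ∈ S, dep g f

variable {dep 𝓑}

lemma touches_cons {g : F} {S : Finset F} {L : List (Finset F)} :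
    Touches dep g (S :: L) ↔ (∃ f ∈ S, dep g f) ∨ Touches dep g L := by
  simp [Touches]

/-! ### Inserting an event into a stable sequence -/

variable [DecidableEq F]

/-- Add `g` to the first layer of a sequence. -/
def addHead (g : F) : List (Finset F) → List (Finset F)
  | [] => [{g}]
  | T :: L => insert g T :: L

open Classical in
variable (dep) in
/-- Add `g` to the layer that follows the last layer on which `g` depends. -/
noncomputable def addLayer (g : F) : List (Finset F) → List (Finset F)
  -- A default value: the recursion stops before the empty list if `g` touches the sequence.
  | [] => [{g}]
  | S :: L => if Touches dep g L then S :: addLayer g L else S :: addHead g L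

lemma head?_addLayer {g : F} {K : List (Finset F)} (h : Touches dep g K) :
    (addLayer dep g K).head? = K.head? := by
  cases K with
  | nil => simp [Touches] at h
  | cons S L => simp only [addLayer]; split_ifs <;> rfl

lemma stable_addHead (hs : ∀ f g, dep f g → dep g f) {g : F} (hg : g ∈ 𝓑) {S : Finset F}
    {L : List (Finset F)} (hK : Stable dep 𝓑 (S :: L)) (hL : ¬ Touches dep g L) :
    Stable dep 𝓑 (addHead g L) := by
  cases L with
  | nil =>
    refine ⟨⟨by simp, by simpa using hg, ?_⟩, by simp, trivial⟩
    intro f hf f' hf' hne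
    simp only [Finset.mem_singleton] at hf hf'
    exact absurd (hf.trans hf'.symm) hne
  | cons T L =>
    obtain ⟨-, -, hT, hTL, hst⟩ := hK
    refine ⟨⟨by simp, Finset.insert_subset hg hT.subset, ?_⟩, ?_, hst⟩
    · have h1 : ∀ f ∈ T, ¬ dep g f := fun f hf h => hL ⟨T, by simp, f, hf, h⟩
      intro f hf f' hf' hne
      rw [Finset.mem_insert] at hf hf'
      rcases hf with rfl | hf <;> rcases hf' with rfl | hf'
      · exact absurd rfl hne
      · exact h1 _ hf'
      · exact fun h => h1 _ hf (hs _ _ h)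
      · exact hT.indep _ hf _ hf' hne
    · intro U hU u hu
      obtain ⟨f, hf, h⟩ := hTL U hU u hu
      exact ⟨f, Finset.mem_insert_of_mem hf, h⟩

lemma stable_addLayer (hs : ∀ f g, dep f g → dep g f) {g : F} (hg : g ∈ 𝓑) :
    ∀ {K : List (Finset F)}, Stable dep 𝓑 K → Touches dep g K → Stable dep 𝓑 (addLayer dep g K)
  | [], _, h => by simp [Touches] at h
  | S :: L, hK, h => by
    simp only [addLayer]
    split_ifs with hL
    · refine ⟨hK.1, ?_, stable_addLayer hs hg hK.2.2 hL⟩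
      rw [head?_addLayer hL]
      exact hK.2.1
    · refine ⟨hK.1, ?_, stable_addHead hs hg hK hL⟩
      have hS : ∃ f ∈ S, dep g f := (touches_cons.1 h).resolve_right hL
      cases L with
      | nil => simpa [addHead] using hS
      | cons T L =>
        intro U hU u hu
        simp only [addHead, List.head?_cons, Option.mem_def, Option.some.injEq] at hU
        subst hU
        rcases Finset.mem_insert.1 hu with rfl | hu
        · exact hS
        · exact hK.2.1 T (by simp) u hu

lemma touches_addHead {g : F} (hg : dep g g) (K : List (Finset F)) :
    Touches dep g (addHead g K) := by
  cases K with
  | nil => exact ⟨{g}, by simp [addHead], g, by simp, hg⟩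
  | cons T L => exact ⟨insert g T, by simp [addHead], g, by simp, hg⟩

/-- An added `g` lands strictly behind the first layer and depends on itself there. This property of
the output recognises where `g` was placed. -/
lemma touches_tail_addLayer {g : F} (hg : dep g g) {K : List (Finset F)} (h : Touches dep g K) :
    Touches dep g (addLayer dep g K).tail := by
  induction K with
  | nil => simp [Touches] at h
  | cons S L ih =>
    simp only [addLayer]
    split_ifs with hL
    · rw [List.tail_cons]
      obtain ⟨T, hT, hf⟩ := ih hL
      exact ⟨T, List.mem_of_mem_tail hT, hf⟩
    · exact touches_addHead hg L

/-- Since `g` depends on itself, it is absent from an untouched layer, so erasing it inverts the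
insertion. A freshly created layer `{g}` cannot come from an insertion because layers are nonempty.
-/
lemma addHead_injOn {g : F} (hg : dep g g) {K K' : List (Finset F)} (hK : Stable dep 𝓑 K)
    (hK' : Stable dep 𝓑 K') (h : ¬ Touches dep g K) (h' : ¬ Touches dep g K')
    (he : addHead g K = addHead g K') : K = K' := by
  have not_mem : ∀ {T L}, ¬ Touches dep g (T :: L) → g ∉ T :=
    fun h hgT => h ⟨_, List.mem_cons_self, g, hgT, hg⟩
  have key : ∀ {T : Finset F} {L}, Stable dep 𝓑 (T :: L) → ¬ Touches dep g (T :: L) →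
      addHead g (T :: L) ≠ [{g}] := by
    intro T L hK h he
    simp only [addHead, List.cons.injEq] at he
    obtain ⟨f, hf⟩ := hK.1.nonempty
    have : f ∈ ({g} : Finset F) := he.1 ▸ Finset.mem_insert_of_mem hf
    exact not_mem h (Finset.mem_singleton.1 this ▸ hf)
  cases K with
  | nil =>
    cases K' with
    | nil => rfl
    | cons T L => exact absurd he.symm (key hK' h')
  | cons T L =>
    cases K' with
    | nil => exact absurd he (key hK h)
    | cons T' L' =>
      simp only [addHead, List.cons.injEq] at he
      rw [he.2]
      congr 1
      rw [← Finset.erase_insert (not_mem h), ← Finset.erase_insert (not_mem h'), he.1]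

lemma addHead_ne_addLayer {g : F} (hg : dep g g) {K K' : List (Finset F)}
    (h : ¬ Touches dep g K) (h' : Touches dep g K') : addHead g K ≠ addLayer dep g K' := by
  intro he
  have := touches_tail_addLayer hg h'
  rw [← he] at this
  cases K with
  | nil => simp [addHead, Touches] at this
  | cons T L => exact h (touches_cons.2 (Or.inr this))

lemma addLayer_injOn {g : F} (hg : dep g g) :
    ∀ {K K' : List (Finset F)}, Stable dep 𝓑 K → Stable dep 𝓑 K' → Touches dep g K →
      Touches dep g K' → addLayer dep g K = addLayer dep g K' → K = K'
  | [], _, _, _, h, _, _ => by simp [Touches] at h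
  | _ :: _, [], _, _, _, h, _ => by simp [Touches] at h
  | S :: L, S' :: L', hK, hK', h, h', he => by
    simp only [addLayer] at he
    split_ifs at he with h1 h2 h2 <;> simp only [List.cons.injEq] at he
    · rw [he.1, addLayer_injOn hg hK.2.2 hK'.2.2 h1 h2 he.2]
    · exact absurd he.2.symm (addHead_ne_addLayer hg h2 h1)
    · exact absurd he.2 (addHead_ne_addLayer hg h1 h2)
    · rw [he.1, addHead_injOn hg hK.2.2 hK'.2.2 h1 h2 he.2]

/-! ### The product along a stable sequence -/

variable {M : Type*} [Monoid M] (A : F → M)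

/-- The product of a layer, in some order. -/
noncomputable def layerProd (S : Finset F) : M := (S.toList.map A).prod

/-- The product of the layers of a sequence; the first layer is the last factor. -/
noncomputable def stableProd : List (Finset F) → M
  | [] => 1
  | S :: L => stableProd L * layerProd A S

variable {A}

/-- Members of a layer are pairwise independent, so their factors commute and the unspecified order
of `toList` does not matter. -/
lemma layerProd_insert (hA : ∀ f ∈ 𝓑, ∀ g ∈ 𝓑, ¬ dep f g → Commute (A f) (A g))
    {S : Finset F} {g : F} (hS : IsLayer dep 𝓑 (insert g S)) (hg : g ∉ S) :
    layerProd A (insert g S) = A g * layerProd A S := by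
  have hp : ((insert g S).toList.map A).Perm ((g :: S.toList).map A) :=
    (Finset.toList_insert hg).map A
  have hc : ((insert g S).toList.map A).Pairwise Commute := by
    rw [List.pairwise_map]
    refine ((insert g S).nodup_toList).imp_of_mem ?_
    intro a b ha hb hne
    rw [Finset.mem_toList] at ha hb
    exact hA a (hS.subset ha) b (hS.subset hb) (hS.indep a ha b hb hne)
  rw [layerProd, hp.prod_eq' hc, List.map_cons, List.prod_cons, layerProd]

lemma commute_stableProd (hA : ∀ f ∈ 𝓑, ∀ g ∈ 𝓑, ¬ dep f g → Commute (A f) (A g)) {g : F}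
    (hg : g ∈ 𝓑) {K : List (Finset F)} (hK : Stable dep 𝓑 K) (h : ¬ Touches dep g K) :
    Commute (A g) (stableProd A K) := by
  induction K with
  | nil => exact Commute.one_right _
  | cons S L ih =>
    rw [touches_cons, not_or] at h
    refine (ih hK.2.2 h.2).mul_right ?_
    refine Commute.list_prod_right _ _ ?_
    intro x hx
    obtain ⟨f, hf, rfl⟩ := List.mem_map.1 hx
    rw [Finset.mem_toList] at hf
    exact hA g hg f (hK.1.subset hf) fun hd => h.1 ⟨f, hf, hd⟩

lemma stableProd_addHead (hs : ∀ f g, dep f g → dep g f)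
    (hA : ∀ f ∈ 𝓑, ∀ g ∈ 𝓑, ¬ dep f g → Commute (A f) (A g)) {g : F} (hg : g ∈ 𝓑)
    (hgg : dep g g) {S : Finset F}
    {L : List (Finset F)} (hK : Stable dep 𝓑 (S :: L)) (h : ¬ Touches dep g L) :
    stableProd A (addHead g L) = A g * stableProd A L := by
  have hst := stable_addHead hs hg hK h
  cases L with
  | nil => simp [addHead, stableProd, layerProd]
  | cons T L =>
    have hgT : g ∉ T := fun hgT => h ⟨_, List.mem_cons_self, g, hgT, hgg⟩
    rw [touches_cons, not_or] at h
    simp only [addHead, stableProd]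
    rw [layerProd_insert hA hst.1 hgT, ← mul_assoc,
      ← (commute_stableProd hA hg hK.2.2.2.2 h.2).eq, mul_assoc]

/-- The layers behind the position of `g` stand to the left of it in the product. None of them is
touched by `g`, so `A g` moves through them to the far left. -/
lemma stableProd_addLayer (hs : ∀ f g, dep f g → dep g f)
    (hA : ∀ f ∈ 𝓑, ∀ g ∈ 𝓑, ¬ dep f g → Commute (A f) (A g)) {g : F} (hg : g ∈ 𝓑)
    (hgg : dep g g) {K : List (Finset F)} (hK : Stable dep 𝓑 K) (h : Touches dep g K) :
    stableProd A (addLayer dep g K) = A g * stableProd A K := by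
  induction K with
  | nil => simp [Touches] at h
  | cons S L ih =>
    simp only [addLayer]
    split_ifs with hL
    · simp only [stableProd]
      rw [ih hK.2.2 hL, mul_assoc]
    · simp only [stableProd]
      rw [stableProd_addHead hs hA hg hgg hK hL, mul_assoc]

end Layers

/-! ### The potential of a configuration -/

section Potential

open Matrix

variable {F : Type*} [DecidableEq F] {dep : F → F → Prop} {𝓑 : Finset F}
  {Ω : Type*} [Fintype Ω] [DecidableEq Ω] {A : F → Matrix Ω Ω ℝ≥0∞}

variable (dep 𝓑) in
/-- The stable sequences whose first layer is `S`. -/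
abbrev StableFrom (S : Finset F) : Type _ :=
  {K : List (Finset F) // Stable dep 𝓑 K ∧ K.head? = some S}

variable (dep 𝓑 A) in
/-- The total weight of the stable sequences with root `f`, seen from the configuration `σ`. -/
noncomputable def potential (f : F) (σ : Ω) : ℝ≥0∞ :=
  ∑' K : StableFrom dep 𝓑 {f}, (stableProd A K.1 *ᵥ 1) σ

lemma mulVec_tsum {ι : Type*} (B : Matrix Ω Ω ℝ≥0∞) (v : ι → Ω → ℝ≥0∞) (σ : Ω) :
    (B *ᵥ fun τ => ∑' i, v i τ) σ = ∑' i, (B *ᵥ v i) σ := by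
  simp only [mulVec, dotProduct, ← ENNReal.tsum_mul_left]
  rw [Summable.tsum_finsetSum fun _ _ => ENNReal.summable]

lemma mulVec_mono_right (B : Matrix Ω Ω ℝ≥0∞) {v w : Ω → ℝ≥0∞} (h : v ≤ w) : B *ᵥ v ≤ B *ᵥ w :=
  fun _ => Finset.sum_le_sum fun j _ => by gcongr; exact h j

open Classical in
variable (dep) in
/-- Add `g` to a sequence whenever it depends on some member of it. -/
noncomputable def absorb (g : F) (K : List (Finset F)) : List (Finset F) :=
  if Touches dep g K then addLayer dep g K else K

lemma touches_addLayer {g : F} (hg : dep g g) {K : List (Finset F)} (h : Touches dep g K) :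
    Touches dep g (addLayer dep g K) := by
  obtain ⟨T, hT, hf⟩ := touches_tail_addLayer hg h
  exact ⟨T, List.mem_of_mem_tail hT, hf⟩

/-- The map `absorb` on rooted stable sequences. -/
noncomputable def absorbFrom (hs : ∀ f g, dep f g → dep g f) {g : F} (hg : g ∈ 𝓑) (S : Finset F)
    (K : StableFrom dep 𝓑 S) : StableFrom dep 𝓑 S :=
  ⟨absorb dep g K.1, by
    unfold absorb
    split_ifs with h
    · exact ⟨stable_addLayer hs hg K.2.1 h, (head?_addLayer h).trans K.2.2⟩
    · exact K.2⟩

lemma absorbFrom_injective (hs : ∀ f g, dep f g → dep g f) {g : F} (hg : g ∈ 𝓑) (hgg : dep g g)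
    (S : Finset F) : Function.Injective (absorbFrom (dep := dep) hs hg S) := by
  rintro ⟨K, hK⟩ ⟨K', hK'⟩ he
  simp only [absorbFrom, Subtype.mk.injEq, absorb] at he ⊢
  split_ifs at he with h h' h'
  · exact addLayer_injOn hgg hK.1 hK'.1 h h' he
  · exact absurd (he ▸ touches_addLayer hgg h) h'
  · exact absurd (he ▸ touches_addLayer hgg h') h
  · exact he

/-- This keeps the term of `[{g}]` free to pay for the resampling of `g`. -/
lemma absorb_ne_singleton {g : F} (hgg : dep g g) (K : List (Finset F)) :
    absorb dep g K ≠ [{g}] := by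
  unfold absorb
  split_ifs with h
  · intro he
    have := touches_tail_addLayer hgg h
    rw [he] at this
    simp [Touches] at this
  · rintro rfl
    exact h ⟨{g}, by simp, g, by simp, hgg⟩

lemma mulVec_stableProd_le (hs : ∀ f g, dep f g → dep g f)
    (hA : ∀ f ∈ 𝓑, ∀ g ∈ 𝓑, ¬ dep f g → Commute (A f) (A g)) {g : F} (hg : g ∈ 𝓑)
    (hgg : dep g g) (h1 : A g *ᵥ 1 ≤ 1) {K : List (Finset F)} (hK : Stable dep 𝓑 K) :
    A g *ᵥ (stableProd A K *ᵥ 1) ≤ stableProd A (absorb dep g K) *ᵥ 1 := by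
  rw [mulVec_mulVec]
  unfold absorb
  split_ifs with h
  · rw [stableProd_addLayer hs hA hg hgg hK h]
  · rw [(commute_stableProd hA hg hK h).eq, ← mulVec_mulVec]
    exact mulVec_mono_right _ h1

/-- Resampling `g` decreases the expected potential of root `f`, by at least `1` if `f = g`. -/
theorem mulVec_potential_add_le (hs : ∀ f g, dep f g → dep g f)
    (hA : ∀ f ∈ 𝓑, ∀ g ∈ 𝓑, ¬ dep f g → Commute (A f) (A g)) {g : F} (hg : g ∈ 𝓑)
    (hgg : dep g g) (h1 : A g *ᵥ 1 ≤ 1) {σ : Ω} (hσ : (A g *ᵥ 1) σ = 1) (f : F) :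
    (A g *ᵥ potential dep 𝓑 A f) σ + (if g = f then 1 else 0) ≤ potential dep 𝓑 A f σ := by
  have hle : (A g *ᵥ potential dep 𝓑 A f) σ ≤
      ∑' K : StableFrom dep 𝓑 {f}, (stableProd A (absorbFrom hs hg _ K).1 *ᵥ 1) σ := by
    unfold potential
    rw [mulVec_tsum]
    exact ENNReal.tsum_le_tsum fun K => mulVec_stableProd_le hs hA hg hgg h1 K.2.1 σ
  have hinj := absorbFrom_injective hs hg hgg {f}
  split_ifs with hgf
  · subst hgf
    -- The term of `K₀` is `(A g *ᵥ 1) σ = 1`; the remaining terms dominate the image of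
    -- `absorbFrom`.
    set K₀ : StableFrom dep 𝓑 {g} := ⟨[{g}], ⟨⟨by simp, by simpa using hg, by simp +contextual⟩,
      by simp, trivial⟩, rfl⟩ with hK₀
    classical
    rw [potential, ENNReal.tsum_eq_add_tsum_ite K₀, add_comm]
    refine add_le_add ?_ (hle.trans ?_)
    · simp [hK₀, stableProd, layerProd, hσ]
    · refine le_trans (le_of_eq ?_) (ENNReal.tsum_comp_le_tsum_of_injective hinj _)
      refine tsum_congr fun K => ?_
      rw [if_neg]
      intro he
      exact absorb_ne_singleton hgg K.1 (congrArg Subtype.val he)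
  · rw [add_zero]
    exact hle.trans (ENNReal.tsum_comp_le_tsum_of_injective hinj
      fun K => (stableProd A K.1 *ᵥ 1) σ)

/-! ### Summing the weights of the stable sequences -/

/-- The product of the weights of all members of a sequence of layers. -/
noncomputable def weight (p : F → ℝ≥0∞) (K : List (Finset F)) : ℝ≥0∞ := (K.map fun S => ∏ f ∈ S, p f).prod

lemma vecMul_stableProd {u : Ω → ℝ≥0∞} {p : F → ℝ≥0∞} (hu : ∀ f ∈ 𝓑, u ᵥ* A f = p f • u)
    {K : List (Finset F)} (hK : Stable dep 𝓑 K) : u ᵥ* stableProd A K = weight p K • u := by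
  have hlist : ∀ l : List F, (∀ f ∈ l, f ∈ 𝓑) → u ᵥ* (l.map A).prod = (l.map p).prod • u := by
    intro l
    induction l with
    | nil => simp
    | cons f l ih =>
      intro hl
      rw [List.map_cons, List.prod_cons, ← vecMul_vecMul, hu f (hl f (by simp)), smul_vecMul,
        ih fun f hf => hl f (by simp [hf]), List.map_cons, List.prod_cons, smul_smul]
  induction K with
  | nil => simp [stableProd, weight]
  | cons S L ih =>
    rw [stableProd, ← vecMul_vecMul, ih hK.2.2, smul_vecMul, layerProd,
      hlist _ fun f hf => hK.1.subset (Finset.mem_toList.1 hf), smul_smul, weight, weight,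
      List.map_cons, List.prod_cons, mul_comm, Finset.prod_map_toList]

lemma tsum_list_eq {α : Type*} (f : List α → ℝ≥0∞) :
    ∑' l, f l = f [] + ∑' a, ∑' l, f (a :: l) := by
  classical
  have hinj : Function.Injective fun x : α × List α => x.1 :: x.2 := by
    rintro ⟨a, l⟩ ⟨b, m⟩ h
    simpa using h
  rw [ENNReal.tsum_eq_add_tsum_ite [], ← ENNReal.tsum_prod, ← hinj.tsum_eq]
  · simp
  · rintro (_ | ⟨a, l⟩) hl
    · simp at hl
    · exact ⟨(a, l), rfl⟩

variable [Fintype F]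

lemma prod_biUnion_le_prod_prod {ι : Type*} [DecidableEq ι] (S : Finset ι) (Γ : ι → Finset F)
    {x : F → ℝ≥0∞} (hx : ∀ f, 1 ≤ x f) : ∏ g ∈ S.biUnion Γ, x g ≤ ∏ f ∈ S, ∏ g ∈ Γ f, x g := by
  induction S using Finset.induction_on with
  | empty => simp
  | insert f S hf ih =>
    rw [Finset.biUnion_insert, Finset.prod_insert hf]
    refine le_trans ?_ (mul_le_mul_right ih _)
    rw [← Finset.prod_union_inter]
    exact le_mul_of_one_le_right zero_le (Finset.one_le_prod' fun g _ => hx g)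

-- The length bound makes induction possible on an infinite sum. After `S` the sequence either ends
-- or continues with a nonempty `T` inside the neighbourhood `Γ` of `S`; the independence of `T` is
-- simply dropped.
open Classical in
lemma tsum_weight_length_le {p μ : F → ℝ≥0∞}
    (hμ : ∀ f ∈ 𝓑, p f * ∏ g ∈ 𝓑 with dep g f, (1 + μ g) ≤ μ f) (k : ℕ) :
    ∀ S : Finset F, (∑' L : List (Finset F),
      if Stable dep 𝓑 (S :: L) ∧ L.length < k then weight p (S :: L) else 0) ≤ ∏ f ∈ S, μ f := by
  induction k with
  | zero => simp
  | succ k ih =>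
    intro S
    by_cases hS : S ⊆ 𝓑
    swap
    · have : ∀ L, ¬ Stable dep 𝓑 (S :: L) := fun L h => hS h.1.subset
      simp [this]
    set Γ := S.biUnion fun f => {g ∈ 𝓑 | dep g f} with hΓ
    have h1 : ∀ T : Finset F, (∑' L : List (Finset F), if Stable dep 𝓑 (S :: T :: L) ∧
        (T :: L).length < k + 1 then weight p (S :: T :: L) else 0) ≤
        (∏ f ∈ S, p f) * if T ∈ Γ.powerset.erase ∅ then ∏ f ∈ T, μ f else 0 := by
      intro T
      split_ifs with hT
      · refine le_trans ?_ (mul_le_mul_right (ih T) _)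
        rw [← ENNReal.tsum_mul_left]
        refine ENNReal.tsum_le_tsum fun L => ?_
        split_ifs with h h'
        · simp [weight]
        · exact absurd ⟨h.1.2.2, by simpa using h.2⟩ h'
        · exact zero_le
        · exact zero_le
      · rw [mul_zero, nonpos_iff_eq_zero, ENNReal.tsum_eq_zero]
        intro L
        rw [if_neg]
        rintro ⟨h, -⟩
        refine hT (Finset.mem_erase.2 ⟨h.2.2.1.nonempty.ne_empty, Finset.mem_powerset.2 ?_⟩)
        intro g hg
        obtain ⟨f, hf, hd⟩ := h.2.1 T (by simp) g hg
        exact Finset.mem_biUnion.2 ⟨f, hf, Finset.mem_filter.2 ⟨h.2.2.1.subset hg, hd⟩⟩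
    calc _ ≤ (∏ f ∈ S, p f) + ∑ T : Finset F,
          (∏ f ∈ S, p f) * if T ∈ Γ.powerset.erase ∅ then ∏ f ∈ T, μ f else 0 := by
          rw [tsum_list_eq, tsum_fintype (L := .unconditional _)]
          refine add_le_add ?_ (Finset.sum_le_sum fun T _ => h1 T)
          split_ifs <;> simp [weight]
      -- The sequence that ends at `S` plays the role of `T = ∅` in the expansion of the product.
      _ = (∏ f ∈ S, p f) * ∏ f ∈ Γ, (1 + μ f) := by
          rw [← Finset.mul_sum, Finset.prod_one_add, ← Finset.add_sum_erase _ _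
            (Finset.empty_mem_powerset Γ), mul_add, Finset.prod_empty, mul_one,
            Finset.sum_ite_mem, Finset.univ_inter]
      _ ≤ (∏ f ∈ S, p f) * ∏ f ∈ S, ∏ g ∈ 𝓑 with dep g f, (1 + μ g) := by
          gcongr
          exact prod_biUnion_le_prod_prod S _ fun _ => le_self_add
      _ ≤ ∏ f ∈ S, μ f := by
          rw [← Finset.prod_mul_distrib]
          exact Finset.prod_le_prod' fun f hf => hμ f (hS hf)

open Classical in
lemma tsum_weight_le {p μ : F → ℝ≥0∞}
    (hμ : ∀ f ∈ 𝓑, p f * ∏ g ∈ 𝓑 with dep g f, (1 + μ g) ≤ μ f) (S : Finset F) :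
    ∑' K : StableFrom dep 𝓑 S, weight p K.1 ≤ ∏ f ∈ S, μ f := by
  refine ENNReal.summable.tsum_le_of_sum_le fun s => ?_
  have hK : ∀ K : StableFrom dep 𝓑 S, S :: K.1.tail = K.1 := fun K => List.cons_head?_tail K.2.2
  set k := s.sup (fun K => K.1.tail.length) + 1
  have hinj : Function.Injective fun K : StableFrom dep 𝓑 S => K.1.tail := by
    intro K K' h
    exact Subtype.ext (by rw [← hK K, ← hK K']; exact congrArg _ h)
  refine le_trans ?_ (tsum_weight_length_le hμ k S)
  refine le_trans ?_ (ENNReal.tsum_comp_le_tsum_of_injective hinj _)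
  refine le_trans (Finset.sum_le_sum fun K hs => ?_) (ENNReal.sum_le_tsum s)
  rw [hK K, if_pos ⟨K.2.1, Nat.lt_succ_of_le (Finset.le_sup (f := fun K => K.1.tail.length) hs)⟩]

open Classical in
/-- The average potential of root `f` is at most `μ f`. -/
theorem dotProduct_potential_le {u : Ω → ℝ≥0∞} (hu1 : ∑ σ, u σ = 1) {p μ : F → ℝ≥0∞}
    (hu : ∀ f ∈ 𝓑, u ᵥ* A f = p f • u)
    (hμ : ∀ f ∈ 𝓑, p f * ∏ g ∈ 𝓑 with dep g f, (1 + μ g) ≤ μ f) (f : F) :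
    ∑ σ, u σ * potential dep 𝓑 A f σ ≤ μ f := by
  have h : ∑ σ, u σ * potential dep 𝓑 A f σ = ∑' K : StableFrom dep 𝓑 {f}, weight p K.1 := by
    simp only [potential, ← ENNReal.tsum_mul_left]
    rw [← Summable.tsum_finsetSum fun _ _ => ENNReal.summable]
    refine tsum_congr fun K => ?_
    change u ⬝ᵥ (stableProd A K.1 *ᵥ 1) = _
    rw [dotProduct_mulVec, vecMul_stableProd hu K.2.1, smul_dotProduct, dotProduct_one, hu1,
      smul_eq_mul, mul_one]
  rw [h]
  simpa using tsum_weight_le hμ {f}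

end Potential

/-! ### The swapping subroutine -/

section Swap

open Equiv

variable {m : ℕ}

/-- The sum of `F` over all outcomes of the swapping subroutine, with multiplicity. -/
noncomputable def swapSum : List (Fin m) → Finset (Fin m) → Perm (Fin m) →
    (Perm (Fin m) → ℝ≥0∞) → ℝ≥0∞
  | [], _, π, F => F π
  | x :: xs, D, π, F => ∑ z ∈ Dᶜ, swapSum xs (insert x D) (π * swap x z) F

/-- The probability of each sequence of choices of the swapping subroutine. -/
noncomputable def swapConst : List (Fin m) → Finset (Fin m) → ℝ≥0∞
  | [], _ => 1
  | x :: xs, D => (Dᶜ.card : ℝ≥0∞)⁻¹ * swapConst xs (insert x D)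

/-- All choice sequences are equally likely, because the number of choices at each step does not
depend on earlier choices. What remains is a plain count, for which identities can be proved by
bijections. -/
lemma sum_swapFrom_mul (F : Perm (Fin m) → ℝ≥0∞) (L : List (Fin m)) :
    ∀ (D : Finset (Fin m)) (π : Perm (Fin m)), L.Nodup → (∀ x ∈ L, x ∉ D) →
      ∑ τ, swapFrom L D π τ * F τ = swapConst L D * swapSum L D π F := by
  induction L with
  | nil => intro D π _ _; simp [swapFrom, swapSum, swapConst, PMF.pure_apply]
  | cons x xs ih =>
    intro D π hL hD
    rw [List.nodup_cons] at hL
    have hne : (Finset.univ \ D).Nonempty := ⟨x, by simpa using hD x (by simp)⟩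
    rw [swapFrom, dif_pos hne, swapSum, swapConst]
    simp only [PMF.bind_apply, PMF.uniformOfFinset_apply, tsum_fintype, ← Finset.compl_eq_univ_sdiff]
    simp only [Finset.sum_mul, ite_mul, zero_mul]
    rw [Finset.sum_comm, Finset.mul_sum]
    rw [← Finset.sum_subset (Finset.subset_univ Dᶜ) (fun z _ hz => by simp [hz])]
    refine Finset.sum_congr rfl fun z hz => ?_
    simp only [hz, if_true, mul_assoc]
    rw [← Finset.mul_sum, ih _ _ hL.2]
    intro y hy
    rw [Finset.mem_insert, not_or]
    exact ⟨fun h => hL.1 (h ▸ hy), hD y (by simp [hy])⟩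

lemma swapFrom_apply_eq {L : List (Fin m)} {D : Finset (Fin m)} (hL : L.Nodup)
    (hD : ∀ x ∈ L, x ∉ D) (π σ : Perm (Fin m)) :
    swapFrom L D π σ = swapConst L D * swapSum L D π (Pi.single σ 1) := by
  rw [← sum_swapFrom_mul _ L D π hL hD]
  simp [Pi.single_apply]

lemma swapSum_congr (L : List (Fin m)) : ∀ (D : Finset (Fin m)) (π : Perm (Fin m))
    {F G : Perm (Fin m) → ℝ≥0∞}, (∀ τ, F τ = G τ) → swapSum L D π F = swapSum L D π G := by
  intro D π F G h
  rw [funext h]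

lemma swapSum_mul (c : ℝ≥0∞) (F : Perm (Fin m) → ℝ≥0∞) (L : List (Fin m)) :
    ∀ (D : Finset (Fin m)) (π : Perm (Fin m)),
      swapSum L D π (fun τ => c * F τ) = c * swapSum L D π F := by
  induction L with
  | nil => intros; rfl
  | cons x xs ih => intro D π; simp only [swapSum, ih, Finset.mul_sum]

lemma swapSum_zero (L : List (Fin m)) (D : Finset (Fin m)) (π : Perm (Fin m)) :
    swapSum L D π (fun _ => 0) = 0 := by
  simpa using swapSum_mul 0 (fun _ => 0) L D π

lemma swapSum_sum {ι : Type*} (s : Finset ι) (F : ι → Perm (Fin m) → ℝ≥0∞) (L : List (Fin m)) :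
    ∀ (D : Finset (Fin m)) (π : Perm (Fin m)),
      swapSum L D π (fun τ => ∑ i ∈ s, F i τ) = ∑ i ∈ s, swapSum L D π (F i) := by
  induction L with
  | nil => intros; rfl
  | cons x xs ih =>
    intro D π
    simp only [swapSum, ih]
    rw [Finset.sum_comm]

lemma swapSum_append (F : Perm (Fin m) → ℝ≥0∞) (L L' : List (Fin m)) :
    ∀ (D : Finset (Fin m)) (π : Perm (Fin m)), swapSum (L ++ L') D π F =
      swapSum L D π fun τ => swapSum L' (D ∪ L.toFinset) τ F := by
  induction L with
  | nil => intro D π; simp [swapSum]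
  | cons x xs ih =>
    intro D π
    simp only [List.cons_append, swapSum, ih]
    have : D ∪ (x :: xs).toFinset = insert x D ∪ xs.toFinset := by
      ext; simp
    rw [this]

/-- A permutation that fixes the entries in `D` permutes the complement of `D`. -/
lemma sum_compl_perm {D : Finset (Fin m)} {s : Perm (Fin m)} (hs : ∀ x ∈ D, s x = x)
    (f : Fin m → ℝ≥0∞) : ∑ z ∈ Dᶜ, f (s z) = ∑ z ∈ Dᶜ, f z := by
  refine Finset.sum_equiv s (fun z => ?_) fun _ _ => rfl
  rw [Finset.mem_compl, Finset.mem_compl, not_iff_not]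
  refine ⟨fun h => by rwa [hs z h], fun h => ?_⟩
  have := s.injective (hs _ h)
  rwa [← this]

/-- A permutation that fixes all entries involved can be moved past the swaps. -/
lemma swapSum_mul_perm {s : Perm (Fin m)} (F : Perm (Fin m) → ℝ≥0∞) (L : List (Fin m)) :
    ∀ (D : Finset (Fin m)) (π : Perm (Fin m)), (∀ x ∈ D, s x = x) → (∀ x ∈ L, s x = x) →
      swapSum L D (π * s) F = swapSum L D π fun τ => F (τ * s) := by
  induction L with
  | nil => intros; rfl
  | cons x xs ih =>
    intro D π hD hL
    have hx : s x = x := hL x (by simp)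
    simp only [swapSum]
    -- Reindexing `z` by `s` absorbs the conjugation of `swap x z` by `s`.
    rw [← sum_compl_perm hD fun z => swapSum xs (insert x D) (π * swap x z) fun τ => F (τ * s)]
    refine Finset.sum_congr rfl fun z _ => ?_
    rw [← ih _ _ (by simpa [hx] using hD) fun y hy => hL y (by simp [hy]), mul_assoc, mul_assoc,
      mul_swap_eq_swap_mul, hx]

/-- Swapping the entries in `L` while avoiding those in `L'` commutes with swapping those in
`L'`. -/
lemma swapSum_comm (F : Perm (Fin m) → ℝ≥0∞) (L L' : List (Fin m)) (D : Finset (Fin m)) :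
    ∀ (E : Finset (Fin m)) (π : Perm (Fin m)), (∀ x ∈ L, x ∉ D ∪ L'.toFinset) →
      D ∪ L'.toFinset ⊆ E →
      swapSum L E π (fun τ => swapSum L' D τ F) = swapSum L' D π fun τ => swapSum L E τ F := by
  induction L with
  | nil => intros; rfl
  | cons x xs ih =>
    intro E π hx hE
    simp only [swapSum]
    rw [swapSum_sum]
    refine Finset.sum_congr rfl fun z hz => ?_
    rw [Finset.mem_compl] at hz
    -- Since `x` and `z` both avoid `D` and `L'`, the swap can be moved past the treatment of `L'`.
    have hfix : ∀ y ∈ D ∪ L'.toFinset, swap x z y = y := fun y hy =>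
      swap_apply_of_ne_of_ne (fun h => hx x (by simp) (h ▸ hy)) fun h => hz (hE (h ▸ hy))
    rw [ih _ _ (fun y hy => hx y (by simp [hy])) (hE.trans (Finset.subset_insert _ _)),
      swapSum_mul_perm _ _ _ _ (fun y hy => hfix y (by simp [hy]))
      (fun y hy => hfix y (by simp [hy]))]

/-- The order in which two entries are treated is irrelevant. -/
lemma sum_swap_swap {D : Finset (Fin m)} {x y : Fin m} (hxy : x ≠ y) (hx : x ∉ D) (hy : y ∉ D)
    (f : Perm (Fin m) → ℝ≥0∞) :
    ∑ z ∈ Dᶜ, ∑ w ∈ (insert x D)ᶜ, f (swap x z * swap y w) =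
      ∑ w ∈ Dᶜ, ∑ z ∈ (insert y D)ᶜ, f (swap y w * swap x z) := by
  have hsplit : ∀ v : Fin m, v ∉ D → ∀ h : Fin m → ℝ≥0∞,
      ∑ z ∈ Dᶜ, h z = h v + ∑ z ∈ (insert v D)ᶜ, h z := by
    intro v hv h
    rw [Finset.compl_insert, Finset.add_sum_erase _ _ (Finset.mem_compl.2 hv)]
  -- The terms `z = y` on the left match the terms `w = z` on the right through `swap x y`; for each
  -- other fixed `z` the terms match through `swap x z`.
  rw [hsplit y hy, Finset.sum_comm (s := Dᶜ)]
  have h1 : ∀ z ∈ (insert y D)ᶜ, ∑ w ∈ Dᶜ, f (swap y w * swap x z) =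
      f (swap y z * swap x z) + ∑ w ∈ (insert x D)ᶜ, f (swap x z * swap y w) := by
    intro z hz
    simp only [Finset.mem_compl, Finset.mem_insert, not_or] at hz
    rw [hsplit z hz.2]
    congr 1
    refine (Finset.sum_equiv (swap x z) (fun w => ?_) fun w _ => ?_).symm
    · simp only [Finset.mem_compl, Finset.mem_insert, not_or, swap_apply_def]
      split_ifs <;> grind
    · rw [mul_swap_eq_swap_mul, swap_apply_of_ne_of_ne hxy.symm (Ne.symm hz.1)]
  rw [Finset.sum_congr rfl h1, Finset.sum_add_distrib]
  congr 1
  refine Finset.sum_equiv (swap x y) (fun w => ?_) fun w hw => ?_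
  · simp only [Finset.mem_compl, Finset.mem_insert, not_or, swap_apply_def]
    split_ifs <;> simp_all
  · simp only [Finset.mem_compl, Finset.mem_insert, not_or] at hw
    congr 1
    by_cases hwy : w = y
    · subst hwy; simp [swap_comm]
    · rw [swap_apply_of_ne_of_ne hw.1 hwy, mul_swap_eq_swap_mul (swap y w),
        swap_apply_of_ne_of_ne hxy (Ne.symm hw.1), swap_apply_right, mul_swap_eq_swap_mul (swap x y)]

lemma swapSum_perm (F : Perm (Fin m) → ℝ≥0∞) {L L' : List (Fin m)} (h : L.Perm L') :
    ∀ (D : Finset (Fin m)) (π : Perm (Fin m)), L.Nodup → (∀ x ∈ L, x ∉ D) →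
      swapSum L D π F = swapSum L' D π F := by
  induction h with
  | nil => intros; rfl
  | cons x _ ih =>
    intro D π hL hD
    rw [List.nodup_cons] at hL
    refine Finset.sum_congr rfl fun z _ => ih _ _ hL.2 fun y hy => ?_
    rw [Finset.mem_insert, not_or]
    exact ⟨fun h => hL.1 (h ▸ hy), hD y (by simp [hy])⟩
  | swap x y l =>
    intro D π hL hD
    simp only [swapSum, mul_assoc]
    rw [Finset.insert_comm y x D]
    refine sum_swap_swap ?_ (hD y (by simp)) (hD x (by simp))
      fun ρ => swapSum l (insert x (insert y D)) (π * ρ) F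
    rintro rfl
    simp at hL
  | trans h₁ _ ih₁ ih₂ =>
    intro D π hL hD
    rw [ih₁ D π hL hD, ih₂ D π (h₁.nodup_iff.1 hL) fun x hx => hD x (h₁.mem_iff.2 hx)]

/-- Only outcomes of the following form occur in the swapping subroutine. -/
lemma swapSum_congr_of_reachable {F G : Perm (Fin m) → ℝ≥0∞} (L : List (Fin m)) :
    ∀ (D : Finset (Fin m)) (π : Perm (Fin m)), L.Nodup → (∀ x ∈ L, x ∉ D) →
      (∀ τ : Perm (Fin m), (∀ x ∉ L, τ x = π x ∨ ∃ y ∈ L, τ x = π y) → (∀ x ∈ D, τ x = π x) →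
        F τ = G τ) → swapSum L D π F = swapSum L D π G := by
  induction L with
  | nil => intro D π _ _ h; exact h π (by simp) (by simp)
  | cons x xs ih =>
    intro D π hL hD h
    rw [List.nodup_cons] at hL
    refine Finset.sum_congr rfl fun z hz => ih _ _ hL.2 (fun y hy => ?_) fun τ h1 h2 => h τ ?_ ?_
    · rw [Finset.mem_insert, not_or]
      exact ⟨fun h => hL.1 (h ▸ hy), hD y (by simp [hy])⟩
    · intro y hy
      have key : ∀ w, w ≠ x → (π * swap x z) w = π w ∨ (π * swap x z) w = π x := by
        intro w hw
        rw [Perm.mul_apply]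
        by_cases hwz : w = z
        · subst hwz; simp
        · rw [swap_apply_of_ne_of_ne hw hwz]; simp
      rw [List.mem_cons, not_or] at hy
      rcases h1 y hy.2 with h1 | ⟨w, hw, h1⟩
      · rw [h1]
        exact (key y hy.1).imp_right fun h => ⟨x, by simp, h⟩
      · rw [h1]
        rcases key w (fun h => hL.1 (h ▸ hw)) with h | h
        · exact Or.inr ⟨w, by simp [hw], h⟩
        · exact Or.inr ⟨x, by simp, h⟩
    · intro y hy
      rw [h2 y (Finset.mem_insert_of_mem hy), Perm.mul_apply, swap_apply_of_ne_of_ne]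
      · rintro rfl; exact hD y (by simp) hy
      · rintro rfl; exact Finset.mem_compl.1 hz hy

open Classical in
/-- Requiring that the entries in `E` do not change amounts to avoiding these entries. -/
lemma swapSum_restrict (F : Perm (Fin m) → ℝ≥0∞) (E : Finset (Fin m)) (L : List (Fin m)) :
    ∀ (D : Finset (Fin m)) (π : Perm (Fin m)), L.Nodup → (∀ x ∈ L, x ∉ D) → (∀ x ∈ L, x ∉ E) →
      swapSum L D π (fun τ => if ∀ x ∈ E, τ x = π x then F τ else 0) =
        swapSum L (D ∪ E) π F := by
  induction L with
  | nil => intro D π _ _ _; simp [swapSum]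
  | cons x xs ih =>
    intro D π hL hD hE
    rw [List.nodup_cons] at hL
    have hD' : ∀ y ∈ xs, y ∉ insert x D := fun y hy => by
      rw [Finset.mem_insert, not_or]
      exact ⟨fun h => hL.1 (h ▸ hy), hD y (by simp [hy])⟩
    have hxE := hE x (by simp)
    simp only [swapSum]
    rw [← Finset.sum_subset (s₁ := (D ∪ E)ᶜ) (s₂ := Dᶜ)]
    · refine Finset.sum_congr rfl fun z hz => ?_
      simp only [Finset.mem_compl, Finset.mem_union, not_or] at hz
      rw [← Finset.insert_union, ← ih _ _ hL.2 hD' fun y hy => hE y (by simp [hy])]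
      refine swapSum_congr _ _ _ fun τ => ?_
      have : ∀ y ∈ E, (π * swap x z) y = π y := fun y hy => by
        rw [Perm.mul_apply, swap_apply_of_ne_of_ne]
        · rintro rfl; exact hxE hy
        · rintro rfl; exact hz.2 hy
      congr 1
      exact propext (forall₂_congr fun y hy => by rw [this y hy])
    · exact Finset.compl_subset_compl.2 Finset.subset_union_left
    -- Swapping `x` with `z ∈ E` moves the value `π z` to `x`, which is frozen afterwards, so the
    -- value cannot return to `z`.
    · intro z hz hz'
      simp only [Finset.mem_compl, Finset.mem_union, not_not] at hz hz'
      have hzE := hz'.resolve_left hz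
      have hxz : z ≠ x := by rintro rfl; exact hxE hzE
      refine (swapSum_congr_of_reachable _ _ _ hL.2 hD' fun τ h1 _ => ?_).trans (swapSum_zero _ _ _)
      rw [if_neg]
      intro h
      have hz1 := h z hzE
      rcases h1 z (fun hz => hE z (by simp [hz]) hzE) with h1 | ⟨w, hw, h1⟩
      · rw [hz1, Perm.mul_apply, swap_apply_right] at h1
        exact hxz (π.injective h1)
      · rw [hz1, Perm.mul_apply] at h1
        have h2 := π.injective h1
        have h3 : swap x z z = w := swap_apply_eq_iff.2 h2
        rw [swap_apply_right] at h3
        exact hL.1 (h3 ▸ hw)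

/-! ### The transition matrix of a single permutation -/

open Classical in
/-- The transition matrix of the swapping subroutine for the entries in `L`, restricted to the
permutations that agree with `g` on `L`. -/
noncomputable def swapMatrix (L : List (Fin m)) (g : Perm (Fin m)) :
    Matrix (Perm (Fin m)) (Perm (Fin m)) ℝ≥0∞ :=
  Matrix.of fun π σ => if ∀ x ∈ L, π x = g x then swapPMF π L σ else 0

-- After treating `L`, an entry of `L'` holds its old value or one of the values `g x`, which `g'`
-- does not take on `L'`. So agreement with `g'` must hold beforehand and survive, which means that
-- the swaps avoid `L'`. The resulting formula is symmetric up to the order of the concatenated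
-- list.
open Classical in
lemma swapMatrix_mul_apply {L L' : List (Fin m)} (hL : L.Nodup) (hL' : L'.Nodup)
    (hd : ∀ x ∈ L, x ∉ L') {g g' : Perm (Fin m)} (hg : ∀ x ∈ L, ∀ y ∈ L', g x ≠ g' y)
    (π σ : Perm (Fin m)) : (swapMatrix L g * swapMatrix L' g') π σ =
      if (∀ x ∈ L, π x = g x) ∧ (∀ x ∈ L', π x = g' x) then
        swapConst L ∅ * swapConst L' ∅ * swapSum (L' ++ L) ∅ π (Pi.single σ 1) else 0 := by
  simp only [Matrix.mul_apply, swapMatrix, Matrix.of_apply, swapPMF,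
    swapFrom_apply_eq hL' (fun _ _ => Finset.notMem_empty _)]
  by_cases h : ∀ x ∈ L, π x = g x
  swap
  · rw [if_neg fun h' => h h'.1]
    simp [h]
  simp only [if_pos h]
  rw [sum_swapFrom_mul _ L ∅ π hL (fun _ _ => Finset.notMem_empty _)]
  by_cases h' : ∀ x ∈ L', π x = g' x
  · rw [if_pos ⟨h, h'⟩, mul_assoc, swapSum_append,
      ← swapSum_comm _ L L' ∅ _ _ (by simpa using hd) subset_rfl,
      ← swapSum_restrict _ _ _ _ _ hL (by simp) (by simpa using hd)]
    congr 1
    rw [← swapSum_mul]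
    refine swapSum_congr _ _ _ fun τ => ?_
    rw [mul_ite, mul_zero]
    congr 1
    refine propext ⟨fun h1 y hy => ?_, fun h1 y hy => ?_⟩
    · rw [List.mem_toFinset] at hy
      rw [h1 y hy, h' y hy]
    · rw [h1 y (by simpa using hy), h' y hy]
  · rw [if_neg fun h => h' h.2, mul_eq_zero]
    right
    push Not at h'
    obtain ⟨y, hy, hne⟩ := h'
    refine (swapSum_congr_of_reachable _ _ _ hL (by simp) fun τ h1 _ => ?_).trans
      (swapSum_zero L ∅ π)
    rw [if_neg]
    intro h2
    rcases h1 y (fun hyL => hd y hyL hy) with h1 | ⟨x, hx, h1⟩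
    · exact hne (h1.symm.trans (h2 y hy))
    · exact hg x hx y hy (by rw [← h x hx, ← h1, h2 y hy])

/-- Swaps for sets of entries that overlap neither in the domain nor in the range commute. -/
theorem swapMatrix_commute {L L' : List (Fin m)} (hL : L.Nodup) (hL' : L'.Nodup)
    (hd : ∀ x ∈ L, x ∉ L') {g g' : Perm (Fin m)} (hg : ∀ x ∈ L, ∀ y ∈ L', g x ≠ g' y) :
    Commute (swapMatrix L g) (swapMatrix L' g') := by
  ext π σ
  rw [swapMatrix_mul_apply hL hL' hd hg,
    swapMatrix_mul_apply hL' hL (fun x hx hx' => hd x hx' hx) fun x hx y hy => (hg y hy x hx).symm,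
    swapSum_perm _ List.perm_append_comm _ _
      (List.nodup_append'.2 ⟨hL', hL, fun x hx hx' => hd x hx' hx⟩) (by simp),
    mul_comm (swapConst L ∅)]
  exact if_congr and_comm rfl rfl

/-! ### Resampling a random permutation -/

/-- The swapping subroutine does not move the entries in `D`. -/
lemma swapSum_single_eq_zero {L : List (Fin m)} {D : Finset (Fin m)} {π σ : Perm (Fin m)}
    (hL : L.Nodup) (hD : ∀ x ∈ L, x ∉ D) (h : ¬ ∀ x ∈ D, π x = σ x) :
    swapSum L D π (Pi.single σ 1) = 0 := by
  refine (swapSum_congr_of_reachable _ _ _ hL hD fun τ _ h1 => ?_).trans (swapSum_zero L D π)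
  rw [Pi.single_apply, if_neg]
  rintro rfl
  exact h fun x hx => (h1 x hx).symm

open Classical in
/-- Every permutation is obtained in exactly one way from permutations that agree with `g` on
`L`. -/
lemma sum_swapSum_eq_one (σ : Perm (Fin m)) (L : List (Fin m)) :
    ∀ (D : Finset (Fin m)) (g : Perm (Fin m)), L.Nodup → (∀ x ∈ L, x ∉ D) →
      (∀ x ∈ D, g x = σ x) →
      ∑ π : Perm (Fin m), (if ∀ x ∈ L, π x = g x then swapSum L D π (Pi.single σ 1) else 0) = 1 := by
  induction L with
  | nil => intro D g _ _ _; simp [swapSum, Pi.single_apply]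
  | cons x xs ih =>
    intro D g hL hD hg
    rw [List.nodup_cons] at hL
    have hD' : ∀ y ∈ xs, y ∉ insert x D := fun y hy => by
      rw [Finset.mem_insert, not_or]
      exact ⟨fun h => hL.1 (h ▸ hy), hD y (by simp [hy])⟩
    have hxD := hD x (by simp)
    have hg' : ∀ y ∈ insert x D, (swap (g x) (σ x) * g) y = σ y := by
      intro y hy
      rw [Perm.mul_apply]
      rcases Finset.mem_insert.1 hy with rfl | hy
      · simp
      · have hyx : y ≠ x := fun h => hxD (h ▸ hy)
        rw [swap_apply_of_ne_of_ne, hg y hy]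
        · exact fun h => hyx (g.injective h)
        · rw [hg y hy]
          exact fun h => hyx (σ.injective h)
    -- Correcting `g` by this swap makes it agree with `σ` at `x` too, as the induction hypothesis
    -- demands.
    refine Eq.trans ?_ (ih (insert x D) (swap (g x) (σ x) * g) hL.2 hD' hg')
    have h1 : ∀ π : Perm (Fin m), (if ∀ y ∈ x :: xs, π y = g y then
        swapSum (x :: xs) D π (Pi.single σ 1) else 0) = ∑ z ∈ Dᶜ,
        if ∀ y ∈ x :: xs, π y = g y then
          swapSum xs (insert x D) (π * swap x z) (Pi.single σ 1) else 0 := by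
      intro π
      split_ifs
      · rfl
      · simp
    rw [Finset.sum_congr rfl fun π _ => h1 π, Finset.sum_comm]
    have h2 : ∀ z ∈ Dᶜ, (∑ π : Perm (Fin m), if ∀ y ∈ x :: xs, π y = g y then
          swapSum xs (insert x D) (π * swap x z) (Pi.single σ 1) else 0) =
        ∑ π : Perm (Fin m), if ∀ y ∈ x :: xs, (π * swap x z) y = g y then
          swapSum xs (insert x D) π (Pi.single σ 1) else 0 := by
      intro z _
      refine Fintype.sum_equiv (Equiv.mulRight (swap x z)) _ _ fun π => ?_
      simp only [Equiv.coe_mulRight, mul_assoc, swap_mul_self, mul_one]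
    rw [Finset.sum_congr rfl h2, Finset.sum_comm]
    refine Finset.sum_congr rfl fun π _ => ?_
    by_cases hπ : ∀ y ∈ insert x D, π y = σ y
    swap
    · simp [swapSum_single_eq_zero hL.2 hD' hπ]
    have hπx : π x = σ x := hπ x (by simp)
    -- Here `π` is the permutation after the first swap: the value `g x` now sits at `z`, so the
    -- swap partner is determined.
    have hz : ∀ z, (∀ y ∈ x :: xs, (π * swap x z) y = g y) ↔
        z = π.symm (g x) ∧ ∀ y ∈ xs, π y = (swap (g x) (σ x) * g) y := by
      intro z
      rw [List.forall_mem_cons, Perm.mul_apply, swap_apply_left, eq_symm_apply]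
      refine and_congr_right fun hz => forall₂_congr fun y _ => ?_
      rw [mul_swap_eq_swap_mul, hz, hπx, Perm.mul_apply, Perm.mul_apply, swap_comm, swap_apply_eq_iff]
    simp only [hz, ite_and]
    rw [Finset.sum_ite_eq', if_pos]
    rw [Finset.mem_compl]
    intro hmem
    have h3 := hπ _ (Finset.mem_insert_of_mem hmem)
    rw [apply_symm_apply, ← hg _ hmem] at h3
    rw [← g.injective h3] at hmem
    exact hxD hmem

/-- Resampling a uniformly random permutation among those that agree with `g` on `L` produces a
uniformly random permutation. -/
theorem sum_swapMatrix {L : List (Fin m)} (hL : L.Nodup) (g σ : Perm (Fin m)) :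
    ∑ π, swapMatrix L g π σ = swapConst L ∅ := by
  classical
  simp only [swapMatrix, Matrix.of_apply, swapPMF,
    swapFrom_apply_eq hL (fun _ _ => Finset.notMem_empty _)]
  conv_rhs => rw [← mul_one (swapConst L ∅), ← sum_swapSum_eq_one σ L ∅ g hL (by simp) (by simp),
    Finset.mul_sum]
  exact Finset.sum_congr rfl fun π _ => by rw [mul_ite, mul_zero]

end Swap

/-! ### The transition matrices of the resampling steps -/

section Events

open Matrix

variable {N : ℕ} {n : Fin N → ℕ}

lemma Dep.symm {B B' : BadEvent n} (h : Dep B B') : Dep B' B := by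
  obtain ⟨k, x, y, x', y', hB, hB', h⟩ := h
  exact ⟨k, x', y', x, y, hB', hB, h.imp Eq.symm Eq.symm⟩

lemma dep_self {B : BadEvent n} (h : B.Nonempty) : Dep B B := by
  obtain ⟨⟨k, x, y⟩, hB⟩ := h
  exact ⟨k, x, y, x, y, hB, hB, Or.inl rfl⟩

/-- The partial injections that form a consistent event extend to permutations. -/
lemma Consistent.exists_extension {B : BadEvent n} (hB : Consistent B) :
    ∃ g : Config n, ∀ k x y, ⟨k, (x, y)⟩ ∈ B → g k x = y := by
  have : ∀ k, ∃ g : Equiv.Perm (Fin (n k)), ∀ x y, ⟨k, (x, y)⟩ ∈ B → g x = y := by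
    intro k
    let s : Set (Fin (n k)) := {x | ∃ y, ⟨k, (x, y)⟩ ∈ B}
    have hs : ∀ x, ∃ y, x ∈ s → ⟨k, (x, y)⟩ ∈ B := by
      intro x
      by_cases hx : x ∈ s
      · exact hx.imp fun _ h _ => h
      · exact ⟨x, fun h => absurd h hx⟩
    choose f hf using hs
    have hinj : Set.InjOn f s := by
      intro x hx x' hx' h
      exact hB.2 k x x' (f x') (h ▸ hf x hx) (hf x' hx')
    obtain ⟨g, hg⟩ := Set.MapsTo.exists_equiv_extend_of_card_eq (t := Finset.univ)
      (by simp) (f := f) (s := s) (fun _ _ => by simp) hinj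
    refine ⟨g.trans (Equiv.subtypeUnivEquiv fun x => Finset.mem_univ x), fun x y hxy => ?_⟩
    have hx : x ∈ s := ⟨y, hxy⟩
    exact (hg x hx).trans (hB.1 k x _ _ (hf x hx) hxy)
  choose g hg using this
  exact ⟨g, hg⟩

open Classical in
/-- The transition matrix of the resampling of `B`, restricted to the configurations for which `B`
is true. -/
noncomputable def eventMatrix (o : EntryOrder n) (B : BadEvent n) :
    Matrix (Config n) (Config n) ℝ≥0∞ :=
  Matrix.of fun π σ => if Holds B π then resamplePMF o B π σ else 0

lemma eventMatrix_apply (o : EntryOrder n) {B : BadEvent n} {g : Config n}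
    (hg : ∀ k x y, ⟨k, (x, y)⟩ ∈ B → g k x = y) (π σ : Config n) :
    eventMatrix o B π σ = ∏ k, swapMatrix (o.entries B k) (g k) (π k) (σ k) := by
  classical
  simp only [eventMatrix, swapMatrix, Matrix.of_apply]
  rw [Finset.prod_ite_zero]
  have hiff : Holds B π ↔ ∀ k ∈ Finset.univ, ∀ x ∈ o.entries B k, π k x = g k x := by
    constructor
    · intro h k _ x hx
      obtain ⟨y, hy⟩ := (o.mem_entries B k x).1 hx
      rw [h k x y hy, hg k x y hy]
    · intro h k x y hxy
      rw [h k (Finset.mem_univ k) x ((o.mem_entries B k x).2 ⟨y, hxy⟩), hg k x y hxy]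
  by_cases h : Holds B π
  · rw [if_pos h, if_pos (hiff.1 h)]
    rfl
  · rw [if_neg h, if_neg (hiff.not.1 h)]

theorem eventMatrix_commute (o : EntryOrder n) {B B' : BadEvent n} (hB : Consistent B)
    (hB' : Consistent B') (h : ¬ Dep B B') : Commute (eventMatrix o B) (eventMatrix o B') := by
  obtain ⟨g, hg⟩ := hB.exists_extension
  obtain ⟨g', hg'⟩ := hB'.exists_extension
  have hmul : ∀ (M M' : (k : Fin N) → Matrix (Equiv.Perm (Fin (n k))) (Equiv.Perm (Fin (n k))) ℝ≥0∞)
      (π σ : Config n), ∑ τ : Config n, (∏ k, M k (π k) (τ k)) * ∏ k, M' k (τ k) (σ k) =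
        ∏ k, (M k * M' k) (π k) (σ k) := by
    intro M M' π σ
    simp only [Matrix.mul_apply, ← Finset.prod_mul_distrib]
    rw [Fintype.prod_sum]
  ext π σ
  simp only [Matrix.mul_apply, eventMatrix_apply o hg, eventMatrix_apply o hg']
  rw [hmul (fun k => swapMatrix (o.entries B k) (g k)) fun k => swapMatrix (o.entries B' k) (g' k),
    hmul (fun k => swapMatrix (o.entries B' k) (g' k)) fun k => swapMatrix (o.entries B k) (g k)]
  refine Finset.prod_congr rfl fun k _ => ?_
  rw [(swapMatrix_commute (o.nodup B k) (o.nodup B' k) ?_ ?_).eq]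
  · intro x hx hx'
    obtain ⟨y, hy⟩ := (o.mem_entries B k x).1 hx
    obtain ⟨y', hy'⟩ := (o.mem_entries B' k x).1 hx'
    exact h ⟨k, x, y, x, y', hy, hy', Or.inl rfl⟩
  · intro x hx x' hx' he
    obtain ⟨y, hy⟩ := (o.mem_entries B k x).1 hx
    obtain ⟨y', hy'⟩ := (o.mem_entries B' k x').1 hx'
    rw [hg k x y hy, hg' k x' y' hy'] at he
    exact h ⟨k, x, y, x', y', hy, hy', Or.inr he⟩

lemma sum_pmf {α : Type*} [Fintype α] (p : PMF α) : ∑ a, p a = 1 := by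
  rw [← tsum_fintype (L := .unconditional _), p.tsum_coe]

open Classical in
lemma eventMatrix_mulVec_one (o : EntryOrder n) (B : BadEvent n) (π : Config n) :
    (eventMatrix o B *ᵥ 1) π = if Holds B π then 1 else 0 := by
  simp only [mulVec, dotProduct, Pi.one_apply, mul_one, eventMatrix, Matrix.of_apply]
  split_ifs
  · exact sum_pmf _
  · simp

-- The column sums of the matrix are all equal, so the uniform law is a left eigenvector. Pairing
-- with the vector 1 identifies the eigenvalue.
open Classical in
theorem vecMul_eventMatrix (o : EntryOrder n) {B : BadEvent n} (hB : Consistent B) :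
    ⇑(uniformConfig n) ᵥ* eventMatrix o B =
      ENNReal.ofReal (probΩ B) • ⇑(uniformConfig n) := by
  obtain ⟨g, hg⟩ := hB.exists_extension
  set u : Config n → ℝ≥0∞ := ⇑(uniformConfig n) with hu
  obtain ⟨c, hc⟩ : ∃ c, ∀ π, u π = c :=
    ⟨∏ k, ((Fintype.card (Equiv.Perm (Fin (n k))) : ℕ) : ℝ≥0∞)⁻¹, fun π => by
      change ∏ k, PMF.uniformOfFintype _ (π k) = _
      exact Finset.prod_congr rfl fun k _ => PMF.uniformOfFintype_apply _⟩
  have h1 : u ᵥ* eventMatrix o B = (∏ k, swapConst (o.entries B k) ∅) • u := by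
    ext σ
    simp only [vecMul, dotProduct, hc, eventMatrix_apply o hg, Pi.smul_apply, smul_eq_mul]
    rw [← Finset.mul_sum, mul_comm]
    congr 1
    rw [← Fintype.prod_sum fun k τ => swapMatrix (o.entries B k) (g k) τ (σ k)]
    exact Finset.prod_congr rfl fun k _ => sum_swapMatrix (o.nodup B k) _ _
  have h2 : ∏ k, swapConst (o.entries B k) ∅ = (uniformConfig n).toOuterMeasure {π | Holds B π} := by
    have h3 : u ⬝ᵥ (eventMatrix o B *ᵥ 1) = ∏ k, swapConst (o.entries B k) ∅ := by
      rw [dotProduct_mulVec, h1, smul_dotProduct, dotProduct_one, hu, sum_pmf, smul_eq_mul, mul_one]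
    rw [← h3, PMF.toOuterMeasure_apply_fintype]
    refine Finset.sum_congr rfl fun π _ => ?_
    rw [eventMatrix_mulVec_one]
    simp [Set.indicator_apply, hu]
  rw [h1, h2, probΩ, ENNReal.ofReal_toReal]
  refine ne_top_of_le_ne_top ENNReal.one_ne_top ?_
  rw [PMF.toOuterMeasure_apply_fintype, ← sum_pmf (uniformConfig n)]
  exact Finset.sum_le_sum fun π _ => Set.indicator_le_self _ _ _

end Events

/-! ### The trajectory of the algorithm -/

section Trajectory

open Matrix Preorder

variable {N : ℕ} {n : Fin N → ℕ} {𝓑 : Finset (BadEvent n)}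

lemma tsum_bind_mul {α β : Type*} (p : PMF α) (q : α → PMF β) (H : β → ℝ≥0∞) :
    ∑' b, p.bind q b * H b = ∑' a, p a * ∑' b, q a b * H b := by
  simp only [PMF.bind_apply, ← ENNReal.tsum_mul_right, ← ENNReal.tsum_mul_left]
  rw [ENNReal.tsum_comm]
  simp only [mul_assoc]

lemma tsum_pure_mul {α : Type*} (a : α) (H : α → ℝ≥0∞) : ∑' b, PMF.pure a b * H b = H a := by
  rw [tsum_eq_single a fun b hb => by simp [PMF.pure_apply, hb]]
  simp [PMF.pure_apply]

lemma tsum_map_mul {α β : Type*} (p : PMF α) (f : α → β) (H : β → ℝ≥0∞) :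
    ∑' b, p.map f b * H b = ∑' a, p a * H (f a) := by
  rw [PMF.map, tsum_bind_mul]
  simp only [Function.comp_apply, tsum_pure_mul]

lemma lintegral_toMeasure {α : Type*} [Countable α] [MeasurableSpace α]
    [DiscreteMeasurableSpace α] (p : PMF α) (H : α → ℝ≥0∞) :
    ∫⁻ a, H a ∂p.toMeasure = ∑' a, p a * H a := by
  rw [lintegral_countable']
  refine tsum_congr fun a => ?_
  rw [p.toMeasure_apply_singleton a (measurableSet_singleton a), mul_comm]

lemma lintegral_trajectory_succ (o : EntryOrder n) (r : SelectionRule 𝓑) (t : ℕ)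
    (H : State n → ℝ≥0∞) : ∫⁻ ω, H (ω (t + 1)) ∂swappingAlgorithm o r =
      ∫⁻ ω, ∑' s, stepPMF o r t (frestrictLe t ω) s * H s ∂swappingAlgorithm o r := by
  have hH : Measurable H := Measurable.of_discrete
  have h1 := Kernel.map_frestrictLe_trajMeasure_compProd_eq_map_trajMeasure
    (X := fun _ => State n) (μ₀ := (initialPMF n).toMeasure) (κ := stepKernel o r) (a := t)
  have h2 := congrArg (fun ν => ∫⁻ x, H x.2 ∂ν) h1
  rw [lintegral_map (by fun_prop) (by fun_prop), Measure.lintegral_compProd (by fun_prop),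
    lintegral_map (Measurable.of_discrete) (by fun_prop)] at h2
  rw [swappingAlgorithm, ← h2]
  refine lintegral_congr fun ω => ?_
  exact lintegral_toMeasure _ _

lemma lintegral_trajectory_zero (o : EntryOrder n) (r : SelectionRule 𝓑)
    (H : Config n → ℝ≥0∞) : ∫⁻ ω, H (ω 0).config ∂swappingAlgorithm o r =
      ∑ π, uniformConfig n π * H π := by
  have h1 : (swappingAlgorithm o r).map (frestrictLe (π := fun _ => State n) 0) =
      (initialPMF n).toMeasure.map (MeasurableEquiv.piUnique
        (fun _ : Finset.Iic (0 : ℕ) => State n)).symm := by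
    rw [swappingAlgorithm, Kernel.trajMeasure, Measure.map_comp _ _ (by fun_prop),
      Kernel.traj_map_frestrictLe, Kernel.partialTraj_self, Measure.id_comp]
  have h2 := congrArg (fun ν => ∫⁻ x, H (x ⟨0, by simp⟩).config ∂ν) h1
  rw [lintegral_map (Measurable.of_discrete) (by fun_prop),
    lintegral_map (Measurable.of_discrete) (by fun_prop)] at h2
  refine h2.trans ?_
  rw [← tsum_fintype (L := .unconditional _)]
  refine (lintegral_toMeasure _ _).trans ?_
  rw [initialPMF]
  exact tsum_map_mul _ _ _

/-- The potential of root `B` on the configurations of the algorithm. -/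
noncomputable abbrev eventPotential (𝓑 : Finset (BadEvent n)) (o : EntryOrder n)
    (B : BadEvent n) : Config n → ℝ≥0∞ :=
  potential Dep 𝓑 (eventMatrix o) B

-- The drop in potential holds for each true event separately, hence also on average over a
-- randomized, history-dependent choice.
open Classical in
lemma tsum_step_potential_le (h𝓑 : ∀ B ∈ 𝓑, B.Nonempty ∧ Consistent B) (o : EntryOrder n)
    (r : SelectionRule 𝓑) (t : ℕ) (h : History n t) (B : BadEvent n) :
    ∑' s, stepPMF o r t h s * (eventPotential 𝓑 o B s.config +
      if s.last = some B then 1 else 0) ≤ eventPotential 𝓑 o B h.current := by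
  unfold stepPMF
  split_ifs with hbad
  swap
  · rw [tsum_pure_mul]
    simp
  rw [tsum_bind_mul]
  simp only [tsum_map_mul]
  calc _ ≤ ∑' B', r.choose t h B' * eventPotential 𝓑 o B h.current := by
        refine ENNReal.tsum_le_tsum fun B' => ?_
        by_cases hB' : B' ∈ (r.choose t h).support
        swap
        · rw [PMF.mem_support_iff, not_not] at hB'
          simp [hB']
        obtain ⟨hB', hold⟩ := r.choose_true t h hbad B' hB'
        gcongr
        refine le_trans (le_of_eq ?_) (mulVec_potential_add_le (fun _ _ => Dep.symm)
          (fun B₁ h₁ B₂ h₂ => eventMatrix_commute o (h𝓑 B₁ h₁).2 (h𝓑 B₂ h₂).2) hB'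
          (dep_self (h𝓑 B' hB').1) (fun σ => ?_) (σ := h.current) ?_ B)
        · rw [tsum_fintype]
          simp only [mul_add, Finset.sum_add_distrib, Option.some.injEq]
          rw [← Finset.sum_mul, sum_pmf, one_mul]
          congr 1
          simp only [mulVec, dotProduct, eventMatrix, Matrix.of_apply, if_pos hold]
        · rw [eventMatrix_mulVec_one]
          split_ifs <;> simp
        · rw [eventMatrix_mulVec_one, if_pos hold]
    _ = _ := by rw [ENNReal.tsum_mul_right, PMF.tsum_coe, one_mul]

open Classical in
theorem tsum_lintegral_resampled_le (h𝓑 : ∀ B ∈ 𝓑, B.Nonempty ∧ Consistent B) (o : EntryOrder n)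
    (r : SelectionRule 𝓑) (B : BadEvent n) :
    ∑' t : ℕ, ∫⁻ ω, (if (ω (t + 1)).last = some B then 1 else 0) ∂swappingAlgorithm o r ≤
      ∑ π, uniformConfig n π * eventPotential 𝓑 o B π := by
  set P := swappingAlgorithm o r
  set Φ := eventPotential 𝓑 o B
  have hm : ∀ (H : State n → ℝ≥0∞) (t : ℕ), Measurable fun ω : ℕ → State n => H (ω t) :=
    fun H t => (Measurable.of_discrete (f := H)).comp (measurable_pi_apply t)
  have hstep : ∀ t : ℕ, ∫⁻ ω, Φ (ω (t + 1)).config ∂P +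
      ∫⁻ ω, (if (ω (t + 1)).last = some B then 1 else 0) ∂P ≤ ∫⁻ ω, Φ (ω t).config ∂P := by
    intro t
    rw [← lintegral_add_left (hm (fun s => Φ s.config) (t + 1))]
    refine (lintegral_trajectory_succ o r t
      fun s => Φ s.config + if s.last = some B then 1 else 0).trans_le ?_
    exact lintegral_mono fun ω => tsum_step_potential_le h𝓑 o r t _ B
  refine ENNReal.tsum_le_of_sum_range_le fun T => ?_
  -- Keeping the current potential on the left lets the sum telescope without subtraction in `ℝ≥0∞`.
  refine le_trans (b := ∫⁻ ω, Φ (ω T).config ∂P + _) le_add_self ?_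
  rw [← lintegral_trajectory_zero o r]
  induction T with
  | zero => simp [P]
  | succ T ih =>
    rw [Finset.sum_range_succ, ← add_assoc, add_right_comm]
    exact (add_le_add_left (hstep T) _).trans ih

-- If a bad event is true at time `t`, the iteration that follows resamples some member of `𝓑`,
-- recorded at time `t + 1`.
open Classical in
lemma measure_someBad_le (o : EntryOrder n) (r : SelectionRule 𝓑) (t : ℕ) :
    swappingAlgorithm o r {ω | SomeBad 𝓑 (ω t).config} ≤
      ∑ B ∈ 𝓑, ∫⁻ ω, (if (ω (t + 1)).last = some B then 1 else 0) ∂swappingAlgorithm o r := by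
  have hm : ∀ (H : State n → ℝ≥0∞) (t : ℕ), Measurable fun ω : ℕ → State n => H (ω t) :=
    fun H t => (Measurable.of_discrete (f := H)).comp (measurable_pi_apply t)
  have hms : MeasurableSet {ω : ℕ → State n | SomeBad 𝓑 (ω t).config} :=
    (measurable_pi_apply (X := fun _ => State n) t)
      (MeasurableSet.of_discrete (s := {s : State n | SomeBad 𝓑 s.config}))
  rw [← lintegral_finsetSum _ fun B _ => hm (fun s => if s.last = some B then 1 else 0) (t + 1)]
  rw [lintegral_trajectory_succ o r t fun s => ∑ B ∈ 𝓑, if s.last = some B then 1 else 0,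
    ← lintegral_indicator_one hms]
  refine lintegral_mono fun ω => ?_
  by_cases hbad : SomeBad 𝓑 (ω t).config
  swap
  · simp [hbad]
  have hbad' : SomeBad 𝓑 (History.current (frestrictLe (π := fun _ => State n) t ω)) := hbad
  rw [stepPMF, if_pos hbad', tsum_bind_mul, Set.indicator_of_mem (by exact hbad), Pi.one_apply]
  refine (r.choose t (frestrictLe t ω)).tsum_coe.symm.le.trans (ENNReal.tsum_le_tsum fun B => ?_)
  by_cases hB : B ∈ (r.choose t (frestrictLe t ω)).support
  · have := (r.choose_true t _ hbad' B hB).1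
    rw [tsum_map_mul]
    simp [this, sum_pmf]
  · rw [PMF.mem_support_iff, not_not] at hB
    simp [hB]

/-- The convergence criterion and the bound for the expected number of resamplings. -/
theorem terminates_and_lintegral_le (h𝓑 : ∀ B ∈ 𝓑, B.Nonempty ∧ Consistent B)
    {μ : BadEvent n → ℝ} (hμ0 : ∀ B ∈ 𝓑, 0 ≤ μ B)
    (hμ : ∀ B ∈ 𝓑, μ B ≥ probΩ B * ∏ B' ∈ neighbors 𝓑 B, (1 + μ B'))
    (o : EntryOrder n) (r : SelectionRule 𝓑) :
    (∀ᵐ ω ∂(swappingAlgorithm o r), Terminates 𝓑 ω) ∧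
      ∀ B ∈ 𝓑, ∫⁻ ω, resampleCount B ω ∂(swappingAlgorithm o r) ≤ ENNReal.ofReal (μ B) := by
  classical
  have hbound : ∀ B, ∑' t : ℕ, ∫⁻ ω, (if (ω (t + 1)).last = some B then 1 else 0)
      ∂swappingAlgorithm o r ≤ ENNReal.ofReal (μ B) := by
    intro B
    refine (tsum_lintegral_resampled_le h𝓑 o r B).trans ?_
    refine dotProduct_potential_le (sum_pmf _) (p := fun B => ENNReal.ofReal (probΩ B))
      (μ := fun B => ENNReal.ofReal (μ B))
      (fun B hB => vecMul_eventMatrix o (h𝓑 B hB).2) (fun B hB => ?_) B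
    refine le_trans (le_of_eq ?_) (ENNReal.ofReal_le_ofReal (hμ B hB))
    have hnb : ∀ B' ∈ neighbors 𝓑 B, 0 ≤ μ B' := fun B' h => hμ0 B' (Finset.mem_filter.1 h).1
    rw [ENNReal.ofReal_mul (p := probΩ B) ENNReal.toReal_nonneg,
      ENNReal.ofReal_prod_of_nonneg fun B' h => add_nonneg zero_le_one (hnb B' h)]
    congr 1
    refine Finset.prod_congr (by simp only [neighbors]) fun B' h => ?_
    rw [ENNReal.ofReal_add zero_le_one (hnb B' (by simpa only [neighbors] using h)),
      ENNReal.ofReal_one]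
  constructor
  · have hlim : Filter.Tendsto (fun t : ℕ => ∑ B ∈ 𝓑, ∫⁻ ω,
        (if (ω (t + 1)).last = some B then 1 else 0) ∂swappingAlgorithm o r)
        Filter.atTop (nhds 0) := by
      have := tendsto_finsetSum 𝓑 fun B _ => ENNReal.tendsto_atTop_zero_of_tsum_ne_top
        (ne_top_of_le_ne_top ENNReal.ofReal_ne_top (hbound B))
      rwa [Finset.sum_const_zero] at this
    rw [ae_iff, ← nonpos_iff_eq_zero]
    -- Nontermination lies in the event that something is bad at time `t`, for every `t`, and these
    -- probabilities tend to 0.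
    refine ge_of_tendsto' hlim fun t => le_trans (measure_mono fun ω hω => ?_)
      (measure_someBad_le o r t)
    by_contra h
    exact hω ⟨t, h⟩
  · intro B _
    refine le_trans (le_of_eq ?_) (hbound B)
    unfold resampleCount
    rw [lintegral_tsum]
    intro t
    exact ((Measurable.of_discrete (f := fun s : State n =>
      if s.last = some B then (1 : ℝ≥0∞) else 0)).comp (measurable_pi_apply (t + 1))).aemeasurable

end Trajectory

end SwapLLL

/-! ### The general and the symmetric criterion -/

theorem mainTheorem1 :
    (∀ (N : ℕ) (n : Fin N → ℕ) (𝓑 : Finset (SwapLLL.BadEvent n))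
      (_ : ∀ B ∈ 𝓑, B.Nonempty ∧ SwapLLL.Consistent B)
      (μ : SwapLLL.BadEvent n → ℝ) (_ : ∀ B ∈ 𝓑, 0 ≤ μ B)
      (_ : ∀ B ∈ 𝓑, μ B ≥ SwapLLL.probΩ B * ∏ B' ∈ SwapLLL.neighbors 𝓑 B, (1 + μ B'))
      (o : SwapLLL.EntryOrder n) (r : SwapLLL.SelectionRule 𝓑),
      (∀ᵐ ω ∂(SwapLLL.swappingAlgorithm o r), SwapLLL.Terminates 𝓑 ω) ∧
      ∀ B ∈ 𝓑, ∫⁻ ω, SwapLLL.resampleCount B ω ∂(SwapLLL.swappingAlgorithm o r)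
        ≤ ENNReal.ofReal (μ B)) ∧
    (∃ C : ℝ, ∀ (N : ℕ) (n : Fin N → ℕ) (𝓑 : Finset (SwapLLL.BadEvent n))
      (_ : ∀ B ∈ 𝓑, B.Nonempty ∧ SwapLLL.Consistent B)
      (p : ℝ) (d : ℕ) (_ : ∀ B ∈ 𝓑, SwapLLL.probΩ B ≤ p)
      (_ : ∀ B ∈ 𝓑, ((SwapLLL.neighbors 𝓑 B).erase B).card ≤ d)
      (_ : Real.exp 1 * p * (d + 1) ≤ 1)
      (o : SwapLLL.EntryOrder n) (r : SwapLLL.SelectionRule 𝓑),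
      (∀ᵐ ω ∂(SwapLLL.swappingAlgorithm o r), SwapLLL.Terminates 𝓑 ω) ∧
      ∀ B ∈ 𝓑, ∫⁻ ω, SwapLLL.resampleCount B ω ∂(SwapLLL.swappingAlgorithm o r)
        ≤ ENNReal.ofReal C) := by
  refine ⟨fun N n 𝓑 h𝓑 μ hμ0 hμ o r => SwapLLL.terminates_and_lintegral_le h𝓑 hμ0 hμ o r,
    -- `C = 1` works because the weight used is `e * p ≤ 1 / (d + 1) ≤ 1`.
    1, fun N n 𝓑 h𝓑 p d hp hd hpd o r => ?_⟩
  have hprob : ∀ B : SwapLLL.BadEvent n, 0 ≤ SwapLLL.probΩ B := fun B => ENNReal.toReal_nonneg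
  -- A negative `p` is possible when `𝓑` is empty.
  have hp0 : ∀ B ∈ 𝓑, 0 ≤ p := fun B hB => (hprob B).trans (hp B hB)
  have hep : Real.exp 1 * p ≤ 1 / (d + 1) := by
    rw [le_div_iff₀ (by positivity)]
    exact hpd
  -- The constant weight `e * p` meets the criterion: at most `d + 1` neighbours, the event itself
  -- included, give (1 + ep)^(d+1) ≤ exp(ep(d+1)) ≤ e.
  have key := SwapLLL.terminates_and_lintegral_le h𝓑 (μ := fun _ => Real.exp 1 * p)
    (fun B hB => mul_nonneg (Real.exp_pos 1).le (hp0 B hB)) (fun B hB => ?_) o r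
  · refine ⟨key.1, fun B hB => (key.2 B hB).trans (ENNReal.ofReal_le_ofReal (hep.trans ?_))⟩
    rw [div_le_one (by positivity)]
    simp
  · have h0 := hp0 B hB
    have hx : 0 ≤ Real.exp 1 * p := mul_nonneg (Real.exp_pos 1).le h0
    have hcard : (SwapLLL.neighbors 𝓑 B).card ≤ d + 1 :=
      (Finset.pred_card_le_card_erase.trans (hd B hB) |> Nat.sub_le_iff_le_add.1)
    rw [Finset.prod_const, ge_iff_le]
    calc _ ≤ p * (1 + Real.exp 1 * p) ^ (d + 1) := by
          gcongr
          · exact hp B hB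
          · linarith
      _ ≤ p * Real.exp (Real.exp 1 * p) ^ (d + 1) := by
          gcongr
          rw [add_comm]
          exact Real.add_one_le_exp _
      _ ≤ p * Real.exp 1 := by
          gcongr
          rw [← Real.exp_nat_mul, Real.exp_le_exp]
          push_cast
          linarith
      _ = _ := mul_comm _ _
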